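/- Let $(W_{ij})_{(i,j)\in\mathbb N^2}$ be an array of $\mathbb R^d$-valued random vectors on a probability space which is - separately exchangeable: for all permutations $\pi_1,\pi_2$ of $\mathbb N$, $(W_{ij})_{(i,j)\in\mathbb N^2}\overset{d}{=}(W_{\pi_1(i)\pi_2(j)})_{(i,j)\in\mathbb N^2}$; - dissociated: for all $c_1,c_2\in\mathbb N$, the array $(W_{ij})_{i\le c_1,\,j\le c_2}$ is independent of the array $(W_{ij})_{i>c_1,\,j>c_2}$. For every pair $(N,M)$ of sample sizes let $p_{NM}\in[0,1]$ and let $\{Z_{ij}:1\le i\le N,\,1\le j\le M\}$ (which may depend on $(N,M)$) be i.i.d. Bernoulli$(p_{NM})$ random variables that are independent of the data $\{W_{ij}:1\le i\le N,\,1\le j\le M\}$. Let $\hat L=\sum_{i=1}^N\sum_{j=1}^M Z_{ij}$ be the size of the selected subsample, and suppose that its mean $L=NMp_{NM}$ tends to $\infty$ as $\min\{N,M\}\to\infty$. Let $\Theta\subset\mathbb R^k$ be compact, let $\theta^0\in\Theta$, and let $q:\mathbb R^d\times\mathbb R^k\to\mathbb R$ be such that $q(\cdot,\theta)$ is Borel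 measurable for every $\theta\in\Theta$. Suppose that 1. there is a constant $C$ such that $|q(w,\theta)-q(w,\theta')|\le C\|\theta-\theta'\|$ for all $w$ in the support of the law of $W_{11}$ and all $\theta,\theta'\in\Theta$; 2. $\sup_{\theta\in\Theta}q(W_{11},\theta)$ is integrable; 3. $E[q(W_{11},\theta^0)]<E[q(W_{11},\theta)]$ for all $\theta\in\Theta$ with $\theta\ne\theta^0$. For every $(N,M)$ let $\hat\theta=\hat\theta_{NM}$ be a multiway algorithmic subsampling M-estimator, that is, almost surely on the event $\{\hat L>0\}$, $\hat\theta$ is a solution of $$\max_{\theta\in\Theta}\;-\frac1{\hat L}\sum_{i=1}^N\sum_{j=1}^M Z_{ij}\,q(W_{ij},\theta)$$ ($\hat\theta$ is arbitrary where $\hat L=0$). Then $\hat\theta\overset{P}{\rightarrow}\theta^0$ as $\min\{N,M\}\to\infty$. -/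

import Mathlib

open MeasureTheory ProbabilityTheory Filter Topology

namespace MultiwaySubsampling

/-- The asymptotic regime `min {N, M} → ∞` for the pair `(N, M)` of sample sizes. -/
def minAtTop : Filter (ℕ × ℕ) :=
  comap (fun n : ℕ × ℕ => min n.1 n.2) atTop

section Sampling

variable {Ω E : Type*} [MeasurableSpace Ω] [MeasurableSpace E]

/-- Separate exchangeability: permuting the rows and, separately, the columns of the infinite array
does not change its joint law. -/
def SeparatelyExchangeable (P : Measure Ω) (W : ℕ → ℕ → Ω → E) : Prop :=
  ∀ π₁ π₂ : Equiv.Perm ℕ,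
    IdentDistrib (fun ω (ij : ℕ × ℕ) => W ij.1 ij.2 ω)
      (fun ω (ij : ℕ × ℕ) => W (π₁ ij.1) (π₂ ij.2) ω) P P

/-- Dissociation: for all `c₁, c₂` the upper left `c₁ × c₂` block is independent of the array of
all entries whose row is not among the first `c₁` and whose column is not among the first `c₂`
(rows and columns are numbered from `0`). -/
def Dissociated (P : Measure Ω) (W : ℕ → ℕ → Ω → E) : Prop :=
  ∀ c₁ c₂ : ℕ,
    IndepFun (fun ω (ij : {ij : ℕ × ℕ // ij.1 < c₁ ∧ ij.2 < c₂}) => W ij.1.1 ij.1.2 ω)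
      (fun ω (ij : {ij : ℕ × ℕ // c₁ ≤ ij.1 ∧ c₂ ≤ ij.2}) => W ij.1.1 ij.1.2 ω) P

/-- `Z` is a Bernoulli sample for the data `W` at sample size `(N, M)`: the `N * M` indicators are
i.i.d. Bernoulli with parameter `p` and, jointly, independent of the observed data. -/
structure IsBernoulliSample (P : Measure Ω) (W : ℕ → ℕ → Ω → E) (N M : ℕ) (p : unitInterval)
    (Z : Fin N → Fin M → Ω → ℝ) : Prop where
  measurable : ∀ i j, Measurable (Z i j)
  hasLaw : ∀ i j, HasLaw (Z i j) (bernoulliMeasure (1 : ℝ) 0 p) P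
  iIndep : iIndepFun (fun (ij : Fin N × Fin M) => Z ij.1 ij.2) P
  indep_data : IndepFun (fun ω (ij : Fin N × Fin M) => Z ij.1 ij.2 ω)
    (fun ω (ij : Fin N × Fin M) => W ij.1 ij.2 ω) P

end Sampling

/-- The size `L̂ = ∑ᵢ ∑ⱼ Zᵢⱼ` of the selected subsample. -/
noncomputable def subsampleSize {N M : ℕ} (z : Fin N → Fin M → ℝ) : ℝ :=
  ∑ i, ∑ j, z i j

/-- The M-estimation criterion `Q̂(θ) = - L̂⁻¹ ∑ᵢ ∑ⱼ Zᵢⱼ q(Wᵢⱼ, θ)`. -/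
noncomputable def criterion {E T : Type*} {N M : ℕ} (q : E → T → ℝ)
    (w : Fin N → Fin M → E) (z : Fin N → Fin M → ℝ) (θ : T) : ℝ :=
  -((subsampleSize z)⁻¹ * ∑ i, ∑ j, z i j * q (w i j) θ)

/-- `θ` solves `max_{θ ∈ Θ} Q̂(θ)`. The criterion is undefined for an empty subsample (`L̂ = 0`),
and then nothing is required of `θ`. -/
def IsMEstimate {E T : Type*} {N M : ℕ} (q : E → T → ℝ) (Θ : Set T)
    (w : Fin N → Fin M → E) (z : Fin N → Fin M → ℝ) (θ : T) : Prop :=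
  subsampleSize z ≠ 0 → θ ∈ Θ ∧ IsMaxOn (criterion q w z) Θ θ

end MultiwaySubsampling

open MultiwaySubsampling

/-! Replacing the random normalization `L̂` by its mean `L = NMp` changes the criterion by a
positive factor on `L̂ > 0`, so an M-estimate minimizes the linear statistic `weightedMean`.

This statistic obeys a law of large numbers. For bounded `g` (`integral_sq_weightedMean_sub_le`),
entries sharing neither row nor column are independent, so only coinciding entries and entries
sharing a row or column contribute to the variance, which is at most `K² (1/L + 1/N + 1/M)`. For
integrable `f`, approximate by a bounded `g` in `L¹` of the law of `W 0 0`;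
`integral_abs_weightedMean_le` controls the error uniformly in `(N, M)`.

Consistency is then a Wald-type argument. Outside the `ε`-ball around `θ₀`, compactness gives
finitely many small balls, on each of which the Lipschitz bound keeps the criterion close to its
value at the centre. The law of large numbers at the centres, at `θ₀` and for the constant `1`
excludes a minimizer in any of them, with probability tending to one. -/

namespace MultiwaySubsampling

/-- The weighted average `(N M p)⁻¹ ∑ᵢ ∑ⱼ zᵢⱼ h(wᵢⱼ)`. -/
noncomputable def weightedMean {E : Type*} {N M : ℕ} (p : ℝ) (w : Fin N → Fin M → E)
    (z : Fin N → Fin M → ℝ) (h : E → ℝ) : ℝ :=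
  ((N : ℝ) * M * p)⁻¹ * ∑ i, ∑ j, z i j * h (w i j)

/-! ### Pairs of entries of the array -/

lemma exists_perm_zero_one {i i' : ℕ} (h : i ≠ i') :
    ∃ π : Equiv.Perm ℕ, π 0 = i ∧ π 1 = i' := by
  have h1 : (Equiv.swap 0 i) 1 ≠ i := by
    intro h2
    have := (Equiv.swap 0 i).injective (h2.trans (Equiv.swap_apply_left 0 i).symm)
    omega
  -- The outer swap corrects the image of `1` and fixes `i`, which differs from both swapped points.
  refine ⟨Equiv.swap ((Equiv.swap 0 i) 1) i' * Equiv.swap 0 i, ?_, ?_⟩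
  · rw [Equiv.Perm.mul_apply, Equiv.swap_apply_left]
    exact Equiv.swap_apply_of_ne_of_ne h1.symm h
  · rw [Equiv.Perm.mul_apply, Equiv.swap_apply_left]

variable {Ω E : Type*} [MeasurableSpace Ω] [MeasurableSpace E] {P : Measure Ω}
  {W : ℕ → ℕ → Ω → E}

lemma SeparatelyExchangeable.identDistrib (h : SeparatelyExchangeable P W) (i j : ℕ) :
    IdentDistrib (W i j) (W 0 0) P P := by
  have := (h (Equiv.swap 0 i) (Equiv.swap 0 j)).comp (u := fun f : ℕ × ℕ → E => f (0, 0))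
    (measurable_pi_apply _)
  simpa [Function.comp_def] using this.symm

/-- Dissociation at `c₁ = c₂ = 1` separates the entries `(0, 0)` and `(1, 1)`; row and column
permutations carry this pair to any two entries with distinct rows and distinct columns. -/
lemma SeparatelyExchangeable.indepFun [IsProbabilityMeasure P] (h : SeparatelyExchangeable P W)
    (hd : Dissociated P W) {i i' j j' : ℕ} (hi : i ≠ i') (hj : j ≠ j') :
    IndepFun (W i j) (W i' j') P := by
  obtain ⟨π₁, h1, h1'⟩ := exists_perm_zero_one hi
  obtain ⟨π₂, h2, h2'⟩ := exists_perm_zero_one hj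
  have h00 : IndepFun (W 0 0) (W 1 1) P :=
    (hd 1 1).comp
      (φ := fun f : {ij : ℕ × ℕ // ij.1 < 1 ∧ ij.2 < 1} → E => f ⟨(0, 0), by simp⟩)
      (ψ := fun f : {ij : ℕ × ℕ // 1 ≤ ij.1 ∧ 1 ≤ ij.2} → E => f ⟨(1, 1), by simp⟩)
      (measurable_pi_apply _) (measurable_pi_apply _)
  refine indepFun_of_identDistrib_pair h00 ?_
  have := (h π₁ π₂).comp (u := fun f : ℕ × ℕ → E => (f (0, 0), f (1, 1)))
    ((measurable_pi_apply _).prodMk (measurable_pi_apply _))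
  simpa [Function.comp_def, h1, h1', h2, h2'] using this

/-! ### Second moments of the selected values -/

namespace IsBernoulliSample

variable {N M : ℕ} {p : unitInterval} {Z : Fin N → Fin M → Ω → ℝ}

lemma ae_eq_zero_or_one (hZ : IsBernoulliSample P W N M p Z) (i : Fin N) (j : Fin M) :
    ∀ᵐ ω ∂P, Z i j ω = 0 ∨ Z i j ω = 1 := by
  have hm : MeasurableSet {x : ℝ | x = 0 ∨ x = 1} :=
    (measurableSet_singleton 0).union (measurableSet_singleton 1)
  have hm' : MeasurableSet {x : ℝ | ¬(x = 0 ∨ x = 1)} := hm.compl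
  rw [(hZ.hasLaw i j).ae_iff (p := fun x => x = 0 ∨ x = 1) (measurableSet_setOfPred.1 hm), ae_iff]
  exact bernoulliMeasure_apply_of_notMem_of_notMem p hm' (by simp) (by simp)

lemma integral_eq (hZ : IsBernoulliSample P W N M p Z) (i : Fin N) (j : Fin M) :
    ∫ ω, Z i j ω ∂P = p := by
  rw [(hZ.hasLaw i j).integral_eq, integral_bernoulliMeasure]
  simp

lemma ae_abs_le (hZ : IsBernoulliSample P W N M p Z) (i : Fin N) (j : Fin M) :
    ∀ᵐ ω ∂P, |Z i j ω| ≤ 1 := by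
  filter_upwards [hZ.ae_eq_zero_or_one i j] with ω h
  rcases h with h | h <;> simp [h]

lemma indepFun_comp (hZ : IsBernoulliSample P W N M p Z) {g : E → ℝ} (hg : Measurable g)
    (i : Fin N) (j : Fin M) :
    IndepFun (Z i j) (fun ω => g (W i j ω)) P :=
  hZ.indep_data.comp (φ := fun f : Fin N × Fin M → ℝ => f (i, j))
    (ψ := fun f : Fin N × Fin M → E => g (f (i, j)))
    (measurable_pi_apply _) (hg.comp (measurable_pi_apply _))

lemma integrable_mul [IsProbabilityMeasure P] (hZ : IsBernoulliSample P W N M p Z) {g : E → ℝ}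
    (hg : Measurable g) (i : Fin N) (j : Fin M) (hi : Integrable (fun ω => g (W i j ω)) P) :
    Integrable (fun ω => Z i j ω * g (W i j ω)) P :=
  (hZ.indepFun_comp hg i j).integrable_mul
    (Integrable.of_bound (hZ.measurable i j).aestronglyMeasurable 1 (hZ.ae_abs_le i j)) hi

lemma integral_mul_comp (hW : ∀ i j, Measurable (W i j)) (hZ : IsBernoulliSample P W N M p Z)
    {g : E → ℝ} (hg : Measurable g) (i : Fin N) (j : Fin M) :
    ∫ ω, Z i j ω * g (W i j ω) ∂P = p * ∫ ω, g (W i j ω) ∂P := by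
  rw [(hZ.indepFun_comp hg i j).integral_fun_mul_eq_mul_integral
    (hZ.measurable i j).aestronglyMeasurable (hg.comp (hW i j)).aestronglyMeasurable,
    hZ.integral_eq]

lemma integral_mul_mul_comp (hW : ∀ i j, Measurable (W i j))
    (hZ : IsBernoulliSample P W N M p Z) {g : E → ℝ} (hg : Measurable g)
    {a b : Fin N × Fin M} (hab : a ≠ b) :
    ∫ ω, (Z a.1 a.2 ω * g (W a.1 a.2 ω)) * (Z b.1 b.2 ω * g (W b.1 b.2 ω)) ∂P
      = p ^ 2 * ∫ ω, g (W a.1 a.2 ω) * g (W b.1 b.2 ω) ∂P := by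
  have h1 : IndepFun (fun ω => Z a.1 a.2 ω * Z b.1 b.2 ω)
      (fun ω => g (W a.1 a.2 ω) * g (W b.1 b.2 ω)) P :=
    hZ.indep_data.comp (φ := fun f : Fin N × Fin M → ℝ => f a * f b)
      (ψ := fun f : Fin N × Fin M → E => g (f a) * g (f b))
      (by fun_prop) (by fun_prop)
  have h2 : IndepFun (Z a.1 a.2) (Z b.1 b.2) P := hZ.iIndep.indepFun hab
  have h3 := h1.integral_fun_mul_eq_mul_integral
    ((hZ.measurable _ _).mul (hZ.measurable _ _)).aestronglyMeasurable
    ((hg.comp (hW _ _)).mul (hg.comp (hW _ _))).aestronglyMeasurable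
  have h4 := h2.integral_fun_mul_eq_mul_integral
    (hZ.measurable _ _).aestronglyMeasurable (hZ.measurable _ _).aestronglyMeasurable
  rw [hZ.integral_eq, hZ.integral_eq] at h4
  rw [h4] at h3
  rw [pow_two, ← h3]
  congr 1 with ω
  ring

/-- Covariance bound for the centred selected values `Zᵢⱼ g(Wᵢⱼ) - p E g(W₀₀)`. -/
lemma integral_centered_mul_le [IsProbabilityMeasure P] (hW : ∀ i j, Measurable (W i j))
    (hex : SeparatelyExchangeable P W) (hd : Dissociated P W)
    (hZ : IsBernoulliSample P W N M p Z) {g : E → ℝ} (hg : Measurable g) {K : ℝ}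
    (hK : ∀ w, |g w| ≤ K) (a b : Fin N × Fin M) :
    ∫ ω, (Z a.1 a.2 ω * g (W a.1 a.2 ω) - p * ∫ ω, g (W 0 0 ω) ∂P) *
        (Z b.1 b.2 ω * g (W b.1 b.2 ω) - p * ∫ ω, g (W 0 0 ω) ∂P) ∂P
      ≤ (if a = b then (p : ℝ) * K ^ 2 else 0) +
        ((if a.1 = b.1 then (p : ℝ) ^ 2 * K ^ 2 else 0) +
          (if a.2 = b.2 then (p : ℝ) ^ 2 * K ^ 2 else 0)) := by
  set m := ∫ ω, g (W 0 0 ω) ∂P with hm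
  have hp0 : (0 : ℝ) ≤ p := p.2.1
  have hgi : ∀ i j, Integrable (fun ω => g (W i j ω)) P := fun i j =>
    Integrable.of_bound (hg.comp (hW i j)).aestronglyMeasurable K (ae_of_all _ fun ω => hK _)
  have hmean : ∀ i j, ∫ ω, g (W i j ω) ∂P = m := fun i j =>
    ((hex.identDistrib i j).comp hg).integral_eq
  have hY : ∀ c : Fin N × Fin M, Integrable (fun ω => Z c.1 c.2 ω * g (W c.1 c.2 ω)) P :=
    fun c => hZ.integrable_mul hg _ _ (hgi _ _)
  have hYm : ∀ c : Fin N × Fin M, Measurable (fun ω => Z c.1 c.2 ω * g (W c.1 c.2 ω)) :=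
    fun c => (hZ.measurable _ _).mul (hg.comp (hW _ _))
  have hYb : ∀ c : Fin N × Fin M, ∀ᵐ ω ∂P, |Z c.1 c.2 ω * g (W c.1 c.2 ω)| ≤ K := by
    intro c
    filter_upwards [hZ.ae_abs_le c.1 c.2] with ω h
    rw [abs_mul]
    calc _ ≤ 1 * |g (W c.1 c.2 ω)| := by gcongr
      _ ≤ K := by rw [one_mul]; exact hK _
  have hYY : Integrable (fun ω => (Z a.1 a.2 ω * g (W a.1 a.2 ω)) *
      (Z b.1 b.2 ω * g (W b.1 b.2 ω))) P :=
    (hY b).bdd_mul (hYm a).aestronglyMeasurable (hYb a)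
  have hexp : ∫ ω, (Z a.1 a.2 ω * g (W a.1 a.2 ω) - p * m) *
        (Z b.1 b.2 ω * g (W b.1 b.2 ω) - p * m) ∂P
      = ∫ ω, (Z a.1 a.2 ω * g (W a.1 a.2 ω)) * (Z b.1 b.2 ω * g (W b.1 b.2 ω)) ∂P
        - p ^ 2 * m ^ 2 := by
    have : ∀ ω, (Z a.1 a.2 ω * g (W a.1 a.2 ω) - p * m) *
        (Z b.1 b.2 ω * g (W b.1 b.2 ω) - p * m)
        = (Z a.1 a.2 ω * g (W a.1 a.2 ω)) * (Z b.1 b.2 ω * g (W b.1 b.2 ω))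
          - p * m * (Z a.1 a.2 ω * g (W a.1 a.2 ω)) - p * m * (Z b.1 b.2 ω * g (W b.1 b.2 ω))
          + p ^ 2 * m ^ 2 := fun ω => by ring
    simp_rw [this]
    have hi : Integrable (fun ω => (Z a.1 a.2 ω * g (W a.1 a.2 ω)) *
        (Z b.1 b.2 ω * g (W b.1 b.2 ω)) - p * m * (Z a.1 a.2 ω * g (W a.1 a.2 ω))) P :=
      hYY.sub ((hY a).const_mul (p * m))
    have hi' : Integrable (fun ω => (Z a.1 a.2 ω * g (W a.1 a.2 ω)) *
        (Z b.1 b.2 ω * g (W b.1 b.2 ω)) - p * m * (Z a.1 a.2 ω * g (W a.1 a.2 ω))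
          - p * m * (Z b.1 b.2 ω * g (W b.1 b.2 ω))) P :=
      hi.sub ((hY b).const_mul (p * m))
    rw [integral_add hi' (integrable_const _), integral_sub hi ((hY b).const_mul _),
      integral_sub hYY ((hY a).const_mul _), integral_const_mul, integral_const_mul,
      hZ.integral_mul_comp hW hg, hZ.integral_mul_comp hW hg, hmean, hmean]
    simp only [integral_const, probReal_univ, one_smul]
    ring
  rw [hexp]
  have hn1 : 0 ≤ if a.1 = b.1 then (p : ℝ) ^ 2 * K ^ 2 else 0 := by split_ifs <;> positivity
  have hn2 : 0 ≤ if a.2 = b.2 then (p : ℝ) ^ 2 * K ^ 2 else 0 := by split_ifs <;> positivity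
  by_cases hab : a = b
  · subst hab
    have hle : ∫ ω, (Z a.1 a.2 ω * g (W a.1 a.2 ω)) * (Z a.1 a.2 ω * g (W a.1 a.2 ω)) ∂P
        ≤ ∫ ω, Z a.1 a.2 ω * K ^ 2 ∂P := by
      refine integral_mono_ae hYY
        ((Integrable.of_bound (hZ.measurable _ _).aestronglyMeasurable 1
          (hZ.ae_abs_le _ _)).mul_const _) ?_
      filter_upwards [hZ.ae_eq_zero_or_one a.1 a.2] with ω h
      have := sq_le_sq' (abs_le.1 (hK (W a.1 a.2 ω))).1 (abs_le.1 (hK (W a.1 a.2 ω))).2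
      rcases h with h | h <;> simp [h, ← pow_two, this]
    rw [integral_mul_const, hZ.integral_eq] at hle
    rw [if_pos rfl]
    nlinarith [mul_nonneg (sq_nonneg (p : ℝ)) (sq_nonneg m)]
  · rw [if_neg hab, hZ.integral_mul_mul_comp hW hg hab]
    by_cases hne : a.1 ≠ b.1 ∧ a.2 ≠ b.2
    · have hind : IndepFun (fun ω => g (W a.1 a.2 ω)) (fun ω => g (W b.1 b.2 ω)) P :=
        (hex.indepFun hd (fun h => hne.1 (Fin.ext h)) (fun h => hne.2 (Fin.ext h))).comp hg hg
      rw [hind.integral_fun_mul_eq_mul_integral (hg.comp (hW _ _)).aestronglyMeasurable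
        (hg.comp (hW _ _)).aestronglyMeasurable, hmean, hmean]
      nlinarith
    · have hle : ∫ ω, g (W a.1 a.2 ω) * g (W b.1 b.2 ω) ∂P ≤ K ^ 2 := by
        refine (integral_mono (g := fun _ => K ^ 2)
          ((hgi b.1 b.2).bdd_mul (hg.comp (hW _ _)).aestronglyMeasurable
            (ae_of_all _ fun ω => hK _)) (integrable_const _) ?_).trans (by simp)
        intro ω
        refine (le_abs_self _).trans ?_
        rw [abs_mul, pow_two]
        exact mul_le_mul (hK _) (hK _) (abs_nonneg _) ((abs_nonneg _).trans (hK (W 0 0 ω)))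
      have h1 : (p : ℝ) ^ 2 * K ^ 2 ≤ (if a.1 = b.1 then (p : ℝ) ^ 2 * K ^ 2 else 0) +
          (if a.2 = b.2 then (p : ℝ) ^ 2 * K ^ 2 else 0) := by
        by_cases h : a.1 = b.1
        · rw [if_pos h]; linarith
        · have h' : a.2 = b.2 := by tauto
          rw [if_pos h']; linarith
      nlinarith [mul_nonneg (sq_nonneg (p : ℝ)) (sq_nonneg m),
        mul_le_mul_of_nonneg_left hle (sq_nonneg (p : ℝ))]

/-- Mean square error of the weighted mean of a bounded function. -/
lemma integral_sq_weightedMean_sub_le [IsProbabilityMeasure P] (hW : ∀ i j, Measurable (W i j))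
    (hex : SeparatelyExchangeable P W) (hd : Dissociated P W)
    (hZ : IsBernoulliSample P W N M p Z) (hL : 0 < (N : ℝ) * M * p)
    {g : E → ℝ} (hg : Measurable g) {K : ℝ} (hK : ∀ w, |g w| ≤ K) :
    ∫ ω, (weightedMean p (fun i j => W i j ω) (fun i j => Z i j ω) g
        - ∫ ω, g (W 0 0 ω) ∂P) ^ 2 ∂P
      ≤ K ^ 2 * (((N : ℝ) * M * p)⁻¹ + (N : ℝ)⁻¹ + (M : ℝ)⁻¹) := by
  set m := ∫ ω, g (W 0 0 ω) ∂P with hm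
  have hN : (N : ℝ) ≠ 0 := by rintro h; simp [h] at hL
  have hM : (M : ℝ) ≠ 0 := by rintro h; simp [h] at hL
  have hp : (p : ℝ) ≠ 0 := by rintro h; simp [h] at hL
  let Y : Fin N × Fin M → Ω → ℝ := fun a ω => Z a.1 a.2 ω * g (W a.1 a.2 ω) - p * m
  have hY : ∀ a b, Integrable (fun ω => Y a ω * Y b ω) P := by
    have hYm : ∀ c, Measurable (Y c) := fun c =>
      ((hZ.measurable _ _).mul (hg.comp (hW _ _))).sub_const _
    have hYi : ∀ c, Integrable (Y c) P := fun c =>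
      (hZ.integrable_mul hg _ _ (Integrable.of_bound (hg.comp (hW _ _)).aestronglyMeasurable K
        (ae_of_all _ fun ω => hK _))).sub (integrable_const _)
    intro a b
    refine (hYi b).bdd_mul (hYm a).aestronglyMeasurable (c := K + |p * m|) ?_
    filter_upwards [hZ.ae_abs_le a.1 a.2] with ω h
    refine (abs_sub _ _).trans (add_le_add_left ?_ _)
    rw [abs_mul]
    calc _ ≤ 1 * |g (W a.1 a.2 ω)| := by gcongr
      _ ≤ K := by rw [one_mul]; exact hK _
  have hrew : ∀ ω, (weightedMean p (fun i j => W i j ω) (fun i j => Z i j ω) g - m) ^ 2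
      = (((N : ℝ) * M * p)⁻¹) ^ 2 * ∑ a, ∑ b, Y a ω * Y b ω := by
    intro ω
    rw [← Finset.sum_mul_sum, ← pow_two, ← mul_pow]
    congr 1
    simp only [Y, weightedMean, Fintype.sum_prod_type, Finset.sum_sub_distrib, mul_sub]
    congr 1
    simp
    field_simp
  simp_rw [hrew]
  rw [integral_const_mul, integral_finsetSum _ fun a _ => integrable_finsetSum _ fun b _ => hY a b]
  simp_rw [integral_finsetSum _ fun b _ => hY _ b]
  calc _ ≤ (((N : ℝ) * M * p)⁻¹) ^ 2 * ∑ a : Fin N × Fin M, ∑ b : Fin N × Fin M,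
        ((if a = b then (p : ℝ) * K ^ 2 else 0) +
        ((if a.1 = b.1 then (p : ℝ) ^ 2 * K ^ 2 else 0) +
          (if a.2 = b.2 then (p : ℝ) ^ 2 * K ^ 2 else 0))) := by
        gcongr with a _ b _
        exact hZ.integral_centered_mul_le hW hex hd hg hK a b
    -- There are `NM` diagonal pairs, `NM²` pairs sharing a row and `N²M` sharing a column; dividing
    -- by `(NMp)²` gives the three terms.
    _ = K ^ 2 * (((N : ℝ) * M * p)⁻¹ + (N : ℝ)⁻¹ + (M : ℝ)⁻¹) := by
        have h1 : ∑ a : Fin N × Fin M, ∑ b : Fin N × Fin M,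
            (if a.1 = b.1 then (p : ℝ) ^ 2 * K ^ 2 else 0)
            = ∑ x : Fin N, ∑ _y : Fin M, ∑ x' : Fin N, ∑ _y' : Fin M,
              if x = x' then (p : ℝ) ^ 2 * K ^ 2 else 0 := by
          simp only [Fintype.sum_prod_type]
        have h2 : ∑ a : Fin N × Fin M, ∑ b : Fin N × Fin M,
            (if a.2 = b.2 then (p : ℝ) ^ 2 * K ^ 2 else 0)
            = ∑ _x : Fin N, ∑ y : Fin M, ∑ _x' : Fin N, ∑ y' : Fin M,
              if y = y' then (p : ℝ) ^ 2 * K ^ 2 else 0 := by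
          simp only [Fintype.sum_prod_type]
        simp only [Finset.sum_add_distrib]
        rw [h1, h2]
        simp
        field_simp
        ring

end IsBernoulliSample

end MultiwaySubsampling

/-! ### Law of large numbers -/

namespace MultiwaySubsampling

lemma weightedMean_sub {E : Type*} {N M : ℕ} (p : ℝ) (w : Fin N → Fin M → E)
    (z : Fin N → Fin M → ℝ) (f g : E → ℝ) :
    weightedMean p w z (fun x => f x - g x) = weightedMean p w z f - weightedMean p w z g := by
  simp only [weightedMean, mul_sub, Finset.sum_sub_distrib]

lemma tendsto_fst_minAtTop : Tendsto (fun n : ℕ × ℕ => n.1) minAtTop atTop :=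
  tendsto_atTop_mono (fun n => min_le_left n.1 n.2) tendsto_comap

lemma tendsto_snd_minAtTop : Tendsto (fun n : ℕ × ℕ => n.2) minAtTop atTop :=
  tendsto_atTop_mono (fun n => min_le_right n.1 n.2) tendsto_comap

variable {Ω E : Type*} [MeasurableSpace Ω] [MeasurableSpace E] {P : Measure Ω}
  [IsProbabilityMeasure P] {W : ℕ → ℕ → Ω → E}

namespace IsBernoulliSample

variable {N M : ℕ} {p : unitInterval} {Z : Fin N → Fin M → Ω → ℝ}

lemma integrable_weightedMean (hex : SeparatelyExchangeable P W)
    (hZ : IsBernoulliSample P W N M p Z) {f : E → ℝ} (hf : Measurable f)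
    (hfi : Integrable (fun ω => f (W 0 0 ω)) P) :
    Integrable (fun ω => weightedMean p (fun i j => W i j ω) (fun i j => Z i j ω) f) P :=
  (integrable_finsetSum _ fun i _ => integrable_finsetSum _ fun j _ =>
    hZ.integrable_mul hf i j
      (((hex.identDistrib i j).comp hf).symm.integrable_snd hfi)).const_mul _

/-- The weights are nonnegative, have mean `p` and are independent of the data, so the triangle
inequality makes the weighted mean an `L¹` contraction. This transfers approximation errors without
loss in `(N, M)`. -/
lemma integral_abs_weightedMean_le (hW : ∀ i j, Measurable (W i j))
    (hex : SeparatelyExchangeable P W) (hZ : IsBernoulliSample P W N M p Z)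
    (hL : 0 < (N : ℝ) * M * p) {f : E → ℝ} (hf : Measurable f)
    (hfi : Integrable (fun ω => f (W 0 0 ω)) P) :
    ∫ ω, |weightedMean p (fun i j => W i j ω) (fun i j => Z i j ω) f| ∂P
      ≤ ∫ ω, |f (W 0 0 ω)| ∂P := by
  have hfa : Measurable fun x => |f x| := hf.abs
  have hi : ∀ (i : Fin N) (j : Fin M), Integrable (fun ω => Z i j ω * |f (W i j ω)|) P :=
    fun i j => hZ.integrable_mul hfa i j
      (((hex.identDistrib i j).comp hfa).symm.integrable_snd hfi.abs)
  have hle : ∫ ω, |weightedMean p (fun i j => W i j ω) (fun i j => Z i j ω) f| ∂P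
      ≤ ∫ ω, ((N : ℝ) * M * p)⁻¹ * ∑ i, ∑ j, Z i j ω * |f (W i j ω)| ∂P := by
    refine integral_mono_ae (hZ.integrable_weightedMean hex hf hfi).abs
      ((integrable_finsetSum _ fun i _ => integrable_finsetSum _ fun j _ =>
        hi i j).const_mul _) ?_
    filter_upwards [ae_all_iff.2 fun i => ae_all_iff.2 fun j => hZ.ae_eq_zero_or_one i j] with ω h
    rw [weightedMean, abs_mul, abs_of_pos (inv_pos.2 hL)]
    gcongr
    refine (Finset.abs_sum_le_sum_abs _ _).trans (Finset.sum_le_sum fun i _ =>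
      (Finset.abs_sum_le_sum_abs _ _).trans (Finset.sum_le_sum fun j _ => ?_))
    rcases h i j with h | h <;> simp [h]
  refine hle.trans_eq ?_
  rw [integral_const_mul,
    integral_finsetSum _ fun i _ => integrable_finsetSum _ fun j _ => hi i j]
  simp_rw [integral_finsetSum _ fun j _ => hi _ j]
  have : ∀ (i : Fin N) (j : Fin M),
      ∫ ω, Z i j ω * |f (W i j ω)| ∂P = p * ∫ ω, |f (W 0 0 ω)| ∂P := fun i j => by
    rw [hZ.integral_mul_comp hW hfa]
    congr 1
    exact ((hex.identDistrib i j).comp hfa).integral_eq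
  simp_rw [this]
  simp only [Finset.sum_const, Finset.card_univ, Fintype.card_fin, nsmul_eq_mul]
  rw [← mul_assoc (M : ℝ), ← mul_assoc (N : ℝ), ← mul_assoc (N : ℝ), inv_mul_cancel_left₀ hL.ne']

lemma memLp_weightedMean (hW : ∀ i j, Measurable (W i j)) (hZ : IsBernoulliSample P W N M p Z)
    {g : E → ℝ} (hg : Measurable g) {K : ℝ} (hK : ∀ w, |g w| ≤ K) :
    MemLp (fun ω => weightedMean p (fun i j => W i j ω) (fun i j => Z i j ω) g) 2 P := by
  have h : ∀ (i : Fin N) (j : Fin M), MemLp (fun ω => Z i j ω * g (W i j ω)) 2 P := by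
    intro i j
    refine MemLp.of_bound ((hZ.measurable i j).mul (hg.comp (hW i j))).aestronglyMeasurable K ?_
    filter_upwards [hZ.ae_abs_le i j] with ω h
    rw [Real.norm_eq_abs, abs_mul]
    calc _ ≤ 1 * |g (W i j ω)| := by gcongr
      _ ≤ K := by rw [one_mul]; exact hK _
  have h' : MemLp (fun ω => ∑ i, ∑ j, Z i j ω * g (W i j ω)) 2 P :=
    memLp_finsetSum _ fun i _ => memLp_finsetSum _ fun j _ => h i j
  exact h'.const_mul _

lemma integral_abs_weightedMean_sub_le (hW : ∀ i j, Measurable (W i j))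
    (hex : SeparatelyExchangeable P W) (hd : Dissociated P W)
    (hZ : IsBernoulliSample P W N M p Z) (hL : 0 < (N : ℝ) * M * p)
    {g : E → ℝ} (hg : Measurable g) {K : ℝ} (hK : ∀ w, |g w| ≤ K) {ε : ℝ} (hε : 0 < ε) :
    ∫ ω, |weightedMean p (fun i j => W i j ω) (fun i j => Z i j ω) g
        - ∫ ω, g (W 0 0 ω) ∂P| ∂P
      ≤ ε + ε⁻¹ * (K ^ 2 * (((N : ℝ) * M * p)⁻¹ + (N : ℝ)⁻¹ + (M : ℝ)⁻¹)) := by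
  have hmem : MemLp (fun ω => weightedMean p (fun i j => W i j ω) (fun i j => Z i j ω) g
      - ∫ ω, g (W 0 0 ω) ∂P) 2 P :=
    (hZ.memLp_weightedMean hW hg hK).sub (memLp_const (∫ ω, g (W 0 0 ω) ∂P))
  calc _ ≤ ∫ ω, (ε + ε⁻¹ * (weightedMean p (fun i j => W i j ω) (fun i j => Z i j ω) g
        - ∫ ω, g (W 0 0 ω) ∂P) ^ 2) ∂P := by
        -- The pointwise inequality `|x| ≤ ε + x²/ε` stands in for Cauchy–Schwarz.
        refine integral_mono (hmem.integrable (by norm_num)).abs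
          ((integrable_const _).add (hmem.integrable_sq.const_mul _)) fun ω => ?_
        dsimp only
        generalize weightedMean p (fun i j => W i j ω) (fun i j => Z i j ω) g
          - ∫ ω, g (W 0 0 ω) ∂P = x
        rw [← sq_abs x, inv_mul_eq_div, ← sub_le_iff_le_add', le_div_iff₀ hε]
        nlinarith [sq_nonneg (|x| - ε), mul_nonneg hε.le (abs_nonneg x)]
    _ = ε + ε⁻¹ * ∫ ω, (weightedMean p (fun i j => W i j ω) (fun i j => Z i j ω) g
        - ∫ ω, g (W 0 0 ω) ∂P) ^ 2 ∂P := by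
        rw [integral_add (integrable_const _) (hmem.integrable_sq.const_mul _),
          integral_const_mul]
        simp
    _ ≤ _ := by
        gcongr
        exact hZ.integral_sq_weightedMean_sub_le hW hex hd hL hg hK

end IsBernoulliSample

variable [TopologicalSpace E] [TopologicalSpace.PseudoMetrizableSpace E] [BorelSpace E]
  {p : ℕ → ℕ → unitInterval} {Z : (N M : ℕ) → Fin N → Fin M → Ω → ℝ}

/-- Law of large numbers in `L¹` for Bernoulli subsamples of a dissociated separately exchangeable
array. -/
theorem tendsto_integral_abs_weightedMean_sub (hW : ∀ i j, Measurable (W i j))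
    (hex : SeparatelyExchangeable P W) (hd : Dissociated P W)
    (hp : Tendsto (fun n : ℕ × ℕ => (n.1 : ℝ) * (n.2 : ℝ) * (p n.1 n.2 : ℝ)) minAtTop atTop)
    (hZ : ∀ N M, IsBernoulliSample P W N M (p N M) (Z N M))
    {f : E → ℝ} (hf : Measurable f) (hfi : Integrable (fun ω => f (W 0 0 ω)) P) :
    Tendsto (fun n : ℕ × ℕ => ∫ ω, |weightedMean (p n.1 n.2) (fun i j => W i j ω)
      (fun i j => Z n.1 n.2 i j ω) f - ∫ ω, f (W 0 0 ω) ∂P| ∂P) minAtTop (𝓝 0) := by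
  have : IsProbabilityMeasure (P.map (W 0 0)) :=
    Measure.isProbabilityMeasure_map (hW 0 0).aemeasurable
  refine tendsto_order.2 ⟨fun a ha => Eventually.of_forall fun n =>
    ha.trans_le (integral_nonneg fun ω => abs_nonneg _), fun ε hε => ?_⟩
  have hfi' : Integrable f (P.map (W 0 0)) :=
    (integrable_map_measure hf.aestronglyMeasurable (hW 0 0).aemeasurable).2 hfi
  -- Four errors of at most `ε / 5` arise: the weighted mean of `f - g`, the two terms of the
  -- bounded case, and the difference of the expectations. The spare fifth makes the final
  -- inequality strict.
  obtain ⟨g, hgε, hgi⟩ := hfi'.exists_boundedContinuous_integral_sub_le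
    (ε := ε / 5) (by positivity)
  have hg : Measurable g := g.continuous.measurable
  have hK : ∀ w, |g w| ≤ ‖g‖ := g.norm_coe_le_norm
  have hgi' : Integrable (fun ω => g (W 0 0 ω)) P := hgi.comp_measurable (hW 0 0)
  have hsub : ∫ ω, |f (W 0 0 ω) - g (W 0 0 ω)| ∂P ≤ ε / 5 := by
    have hn : Measurable fun x => ‖f x - g x‖ := (hf.sub hg).norm
    rwa [integral_map (hW 0 0).aemeasurable hn.aestronglyMeasurable] at hgε
  have hmm : |∫ ω, g (W 0 0 ω) ∂P - ∫ ω, f (W 0 0 ω) ∂P| ≤ ε / 5 := by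
    rw [abs_sub_comm, ← integral_sub hfi hgi']
    exact (abs_integral_le_integral_abs).trans hsub
  have hlim : Tendsto (fun n : ℕ × ℕ => (ε / 5)⁻¹ * (‖g‖ ^ 2 *
      (((n.1 : ℝ) * n.2 * p n.1 n.2)⁻¹ + (n.1 : ℝ)⁻¹ + (n.2 : ℝ)⁻¹))) minAtTop (𝓝 0) := by
    have h1 := tendsto_inv_atTop_nhds_zero_nat (𝕜 := ℝ)
    simpa [Function.comp_def] using (((hp.inv_tendsto_atTop.add (h1.comp tendsto_fst_minAtTop)).add
      (h1.comp tendsto_snd_minAtTop)).const_mul (‖g‖ ^ 2)).const_mul (ε / 5)⁻¹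
  filter_upwards [hp.eventually_gt_atTop 0,
    hlim.eventually_lt_const (show 0 < ε / 5 by positivity)] with n hL hn
  have hZ := hZ n.1 n.2
  have hfg : Measurable fun x => f x - g x := hf.sub hg
  have hfgi : Integrable (fun ω => f (W 0 0 ω) - g (W 0 0 ω)) P := hfi.sub hgi'
  have hA := hZ.integral_abs_weightedMean_le hW hex hL hfg hfgi
  have hB := hZ.integral_abs_weightedMean_sub_le hW hex hd hL hg hK
    (show 0 < ε / 5 by positivity)
  have hAi := (hZ.integrable_weightedMean hex hfg hfgi).abs
  have hBi : Integrable (fun ω => |weightedMean (p n.1 n.2) (fun i j => W i j ω)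
      (fun i j => Z n.1 n.2 i j ω) g - ∫ ω, g (W 0 0 ω) ∂P|) P := ((hZ.integrable_weightedMean hex hg hgi').sub
    (integrable_const (∫ ω, g (W 0 0 ω) ∂P))).abs
  calc _ ≤ ∫ ω, ((|weightedMean (p n.1 n.2) (fun i j => W i j ω)
          (fun i j => Z n.1 n.2 i j ω) (fun x => f x - g x)|
        + |weightedMean (p n.1 n.2) (fun i j => W i j ω)
          (fun i j => Z n.1 n.2 i j ω) g - ∫ ω, g (W 0 0 ω) ∂P|) + ε / 5) ∂P := by
        refine integral_mono ((hZ.integrable_weightedMean hex hf hfi).sub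
          (integrable_const _)).abs ((hAi.add hBi).add (integrable_const _)) fun ω => ?_
        simp only [weightedMean_sub]
        refine le_trans ?_ (add_le_add_right hmm _)
        refine le_trans (le_of_eq ?_) (abs_add_three _ _ _)
        congr 1
        ring
    _ ≤ ε / 5 + (ε / 5 + ε / 5) + ε / 5 := by
        have hABi : Integrable (fun ω => |weightedMean (p n.1 n.2) (fun i j => W i j ω)
            (fun i j => Z n.1 n.2 i j ω) (fun x => f x - g x)|
          + |weightedMean (p n.1 n.2) (fun i j => W i j ω)
            (fun i j => Z n.1 n.2 i j ω) g - ∫ ω, g (W 0 0 ω) ∂P|) P := hAi.add hBi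
        rw [integral_add hABi (integrable_const _), integral_add hAi hBi]
        simp only [integral_const, probReal_univ, one_smul]
        linarith [hA.trans hsub]
    _ < ε := by linarith

/-- Weak law of large numbers for Bernoulli subsamples of a dissociated separately exchangeable
array. -/
theorem tendsto_measureReal_weightedMean_sub (hW : ∀ i j, Measurable (W i j))
    (hex : SeparatelyExchangeable P W) (hd : Dissociated P W)
    (hp : Tendsto (fun n : ℕ × ℕ => (n.1 : ℝ) * (n.2 : ℝ) * (p n.1 n.2 : ℝ)) minAtTop atTop)
    (hZ : ∀ N M, IsBernoulliSample P W N M (p N M) (Z N M))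
    {f : E → ℝ} (hf : Measurable f) (hfi : Integrable (fun ω => f (W 0 0 ω)) P)
    {δ : ℝ} (hδ : 0 < δ) :
    Tendsto (fun n : ℕ × ℕ => P.real {ω | δ ≤ |weightedMean (p n.1 n.2) (fun i j => W i j ω)
      (fun i j => Z n.1 n.2 i j ω) f - ∫ ω, f (W 0 0 ω) ∂P|}) minAtTop (𝓝 0) := by
  have h := (tendsto_integral_abs_weightedMean_sub hW hex hd hp hZ hf hfi).const_mul δ⁻¹
  rw [mul_zero] at h
  refine squeeze_zero (fun n => measureReal_nonneg) (fun n => ?_) h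
  rw [inv_mul_eq_div, le_div_iff₀ hδ, mul_comm]
  exact mul_meas_ge_le_integral_of_nonneg (ae_of_all _ fun ω => abs_nonneg _)
    (((hZ n.1 n.2).integrable_weightedMean hex hf hfi).sub (integrable_const _)).abs δ

end MultiwaySubsampling
-- Tools for M-estimation
namespace MultiwaySubsampling

/-- On a non-empty subsample, an M-estimate minimizes the weighted mean of `q(·, θ)`. -/
lemma IsMEstimate.weightedMean_le {E T : Type*} {N M : ℕ} {q : E → T → ℝ} {Θ : Set T}
    {w : Fin N → Fin M → E} {z : Fin N → Fin M → ℝ} {θ θ₀ : T} {p : ℝ}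
    (h : IsMEstimate q Θ w z θ) (hL : 0 < (N : ℝ) * M * p) (hz : 0 < subsampleSize z)
    (hθ₀ : θ₀ ∈ Θ) :
    weightedMean p w z (fun x => q x θ) ≤ weightedMean p w z (fun x => q x θ₀) := by
  have h1 := isMaxOn_iff.1 (h hz.ne').2 θ₀ hθ₀
  simp only [criterion, neg_le_neg_iff] at h1
  exact mul_le_mul_of_nonneg_left (le_of_mul_le_mul_left h1 (inv_pos.2 hz)) (inv_pos.2 hL).le

/-- Identifies `L̂ / L` as a weighted mean, so that the same law of large numbers controls the
subsample size. -/
lemma weightedMean_one {E : Type*} {N M : ℕ} (p : ℝ) (w : Fin N → Fin M → E)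
    (z : Fin N → Fin M → ℝ) :
    weightedMean p w z (fun _ => 1) = ((N : ℝ) * M * p)⁻¹ * subsampleSize z := by
  simp [weightedMean, subsampleSize]

/-- Functions that are uniformly close on the sample have close weighted means. -/
lemma weightedMean_le_add {E : Type*} {N M : ℕ} {p : ℝ} {w : Fin N → Fin M → E}
    {z : Fin N → Fin M → ℝ} (hL : 0 < (N : ℝ) * M * p) (hz : ∀ i j, 0 ≤ z i j) {f g : E → ℝ}
    {c : ℝ} (h : ∀ i j, f (w i j) ≤ g (w i j) + c) :
    weightedMean p w z f ≤ weightedMean p w z g + c * weightedMean p w z (fun _ => 1) := by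
  have : weightedMean p w z g + c * weightedMean p w z (fun _ => 1)
      = weightedMean p w z (fun x => g x + c) := by
    simp only [weightedMean, mul_add, Finset.sum_add_distrib, ← Finset.sum_mul, mul_one]
    ring
  rw [this]
  unfold weightedMean
  gcongr with i _ j _
  · exact hz i j
  · exact h i j

lemma tendsto_measureReal_of_subset_biUnion {Ω ι κ : Type*} [MeasurableSpace Ω] {P : Measure Ω}
    [IsFiniteMeasure P] {l : Filter ι} {A : ι → Set Ω} (t : Finset κ) {B : κ → ι → Set Ω}
    (hA : ∀ᶠ n in l, ∀ᵐ ω ∂P, ω ∈ A n → ∃ x ∈ t, ω ∈ B x n)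
    (hB : ∀ x ∈ t, Tendsto (fun n => P.real (B x n)) l (𝓝 0)) :
    Tendsto (fun n => P.real (A n)) l (𝓝 0) := by
  have hsum : Tendsto (fun n => ∑ x ∈ t, P.real (B x n)) l (𝓝 0) := by
    simpa using tendsto_finsetSum t hB
  refine squeeze_zero' (Eventually.of_forall fun n => measureReal_nonneg) ?_ hsum
  filter_upwards [hA] with n hn
  refine le_trans ?_ (measureReal_biUnion_finset_le t fun x => B x n)
  refine ENNReal.toReal_mono (measure_ne_top _ _) (measure_mono_ae ?_)
  filter_upwards [hn] with ω h hω
  obtain ⟨x, hx, hxB⟩ := h hω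
  exact Set.mem_biUnion hx hxB

/-- A criterion with integrable supremum that is Lipschitz in a bounded parameter is integrable at
each parameter. -/
lemma integrable_of_integrable_iSup {Ω F : Type*} [MeasurableSpace Ω] {P : Measure Ω}
    [IsFiniteMeasure P] [SeminormedAddCommGroup F] {Θ : Set F} (hΘ : Bornology.IsBounded Θ)
    {X : Ω → F → ℝ} {C : ℝ}
    (hlip : ∀ᵐ ω ∂P, ∀ θ ∈ Θ, ∀ θ' ∈ Θ, |X ω θ - X ω θ'| ≤ C * ‖θ - θ'‖)
    (hint : Integrable (fun ω => ⨆ θ : Θ, X ω θ) P) {θ : F} (hθ : θ ∈ Θ)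
    (hX : AEStronglyMeasurable (fun ω => X ω θ) P) : Integrable (fun ω => X ω θ) P := by
  obtain ⟨D, hD⟩ := hΘ.exists_norm_le
  have : Nonempty Θ := ⟨⟨θ, hθ⟩⟩
  refine Integrable.mono' (hint.abs.add (integrable_const (|C| * (D + D)))) hX ?_
  filter_upwards [hlip] with ω h
  -- Besides bounding the supremum, this shows the family is bounded above; otherwise the real `⨆`
  -- would be the default value `0`.
  have hb : ∀ θ' : Θ, X ω θ' ≤ X ω θ + |C| * (D + D) := by
    intro θ'
    have h1 := (le_abs_self _).trans (h θ' θ'.2 θ hθ)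
    have h2 : C * ‖(θ' : F) - θ‖ ≤ |C| * (D + D) := by
      refine mul_le_mul (le_abs_self C) ?_ (norm_nonneg _) (abs_nonneg _)
      exact (norm_sub_le _ _).trans (add_le_add (hD _ θ'.2) (hD _ hθ))
    linarith
  have h1 : (⨆ θ : Θ, X ω θ) ≤ X ω θ + |C| * (D + D) := ciSup_le hb
  have h2 : X ω θ ≤ ⨆ θ : Θ, X ω θ :=
    le_ciSup (f := fun θ : Θ => X ω θ) ⟨_, Set.forall_mem_range.2 hb⟩ ⟨θ, hθ⟩
  have h3 : 0 ≤ |C| * (D + D) := by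
    have := (norm_nonneg θ).trans (hD θ hθ)
    positivity
  rw [Real.norm_eq_abs]
  simp only [Pi.add_apply]
  rw [abs_le]
  constructor
  · linarith [neg_abs_le (⨆ θ : Θ, X ω θ)]
  · linarith [le_abs_self (⨆ θ : Θ, X ω θ)]

end MultiwaySubsampling

/-! ### Consistency -/

theorem lemma3 {Ω : Type*} [MeasurableSpace Ω] (P : Measure Ω) [IsProbabilityMeasure P]
    {d k : ℕ}
    -- the data
    (W : ℕ → ℕ → Ω → EuclideanSpace ℝ (Fin d))
    (hW_meas : ∀ i j, Measurable (W i j))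
    (hW_exch : SeparatelyExchangeable P W)
    (hW_diss : Dissociated P W)
    -- the Bernoulli subsamples; the expected subsample size diverges
    (p : ℕ → ℕ → unitInterval)
    (hp : Tendsto (fun n : ℕ × ℕ => (n.1 : ℝ) * (n.2 : ℝ) * (p n.1 n.2 : ℝ)) minAtTop atTop)
    (Z : (N M : ℕ) → Fin N → Fin M → Ω → ℝ)
    (hZ : ∀ N M, IsBernoulliSample P W N M (p N M) (Z N M))
    -- the parameter space and the criterion function
    (Θ : Set (EuclideanSpace ℝ (Fin k))) (hΘ : IsCompact Θ)
    (θ₀ : EuclideanSpace ℝ (Fin k)) (hθ₀ : θ₀ ∈ Θ)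
    (q : EuclideanSpace ℝ (Fin d) → EuclideanSpace ℝ (Fin k) → ℝ)
    (hq_meas : ∀ θ ∈ Θ, Measurable fun w => q w θ)
    (C : ℝ)
    (hq_lip : ∀ w ∈ (P.map (W 0 0)).support, ∀ θ ∈ Θ, ∀ θ' ∈ Θ,
      |q w θ - q w θ'| ≤ C * ‖θ - θ'‖)
    (hq_int : Integrable (fun ω => ⨆ θ : Θ, q (W 0 0 ω) θ) P)
    (hq_min : ∀ θ ∈ Θ, θ ≠ θ₀ → ∫ ω, q (W 0 0 ω) θ₀ ∂P < ∫ ω, q (W 0 0 ω) θ ∂P)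
    -- the estimator
    (θhat : ℕ → ℕ → Ω → EuclideanSpace ℝ (Fin k))
    (hθhat : ∀ N M, ∀ᵐ ω ∂P,
      IsMEstimate q Θ (fun i j => W i j ω) (fun i j => Z N M i j ω) (θhat N M ω)) :
    TendstoInMeasure P (fun (n : ℕ × ℕ) => θhat n.1 n.2) minAtTop (fun _ => θ₀) := by
  have hlip : ∀ i j, ∀ᵐ ω ∂P, ∀ θ ∈ Θ, ∀ θ' ∈ Θ,
      |q (W i j ω) θ - q (W i j ω) θ'| ≤ C * ‖θ - θ'‖ := by
    intro i j
    have hs : ∀ᵐ w ∂(P.map (W i j)), w ∈ (P.map (W 0 0)).support := by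
      rw [(hW_exch.identDistrib i j).map_eq]
      exact Measure.support_mem_ae
    filter_upwards [ae_of_ae_map (hW_meas i j).aemeasurable hs] with ω h
    exact hq_lip _ h
  have hint : ∀ θ ∈ Θ, Integrable (fun ω => q (W 0 0 ω) θ) P := fun θ hθ =>
    integrable_of_integrable_iSup hΘ.isBounded (hlip 0 0) hq_int hθ
      ((hq_meas θ hθ).comp (hW_meas 0 0)).aestronglyMeasurable
  rw [tendstoInMeasure_iff_measureReal_dist]
  intro ε hε
  set η : EuclideanSpace ℝ (Fin k) → ℝ := fun θ =>
    ∫ ω, q (W 0 0 ω) θ ∂P - ∫ ω, q (W 0 0 ω) θ₀ ∂P with hη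
  set S : Set (EuclideanSpace ℝ (Fin k)) := Θ ∩ {θ | ε ≤ dist θ θ₀} with hS
  have hS_compact : IsCompact S :=
    hΘ.inter_right (isClosed_le continuous_const (continuous_id.dist continuous_const))
  have hη_pos : ∀ θ ∈ S, 0 < η θ := fun θ hθ =>
    sub_pos.2 (hq_min θ hθ.1 fun h => by
      have : ε ≤ dist θ θ₀ := hθ.2
      rw [h, dist_self] at this
      linarith)
  -- The radius makes the Lipschitz error at most `η / 6`; the `+ 1` avoids dividing by zero.
  -- Multiplied by `L̂ / L < 2` the error stays below `η / 3`, and the deviations at the centre and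
  -- at `θ₀` take another `η / 3` each. The total is less than the gap `η`.
  obtain ⟨t, htS, hcover⟩ := hS_compact.elim_nhds_subcover
    (fun θ => Metric.ball θ (η θ / (6 * (|C| + 1)))) (fun θ hθ => Metric.ball_mem_nhds _ (by
      have := hη_pos θ hθ
      positivity))
  set A : (EuclideanSpace ℝ (Fin d) → ℝ) → ℕ × ℕ → Ω → ℝ := fun f n ω =>
    weightedMean (p n.1 n.2) (fun i j => W i j ω) (fun i j => Z n.1 n.2 i j ω) f with hA
  have hlln : ∀ θ ∈ Θ, ∀ δ > 0, Tendsto (fun n => P.real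
      {ω | δ ≤ |A (fun w => q w θ) n ω - ∫ ω, q (W 0 0 ω) θ ∂P|}) minAtTop (𝓝 0) :=
    fun θ hθ δ hδ => tendsto_measureReal_weightedMean_sub hW_meas hW_exch hW_diss hp hZ
      (hq_meas θ hθ) (hint θ hθ) hδ
  -- Off this event `0 < L̂ / L < 2`: the lower bound makes the subsample nonempty, the upper one
  -- controls the Lipschitz error.
  have hone : Tendsto (fun n => P.real {ω | 1 ≤ |A (fun _ => 1) n ω - 1|}) minAtTop (𝓝 0) := by
    simpa using tendsto_measureReal_weightedMean_sub hW_meas hW_exch hW_diss hp hZ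
      (f := fun _ => 1) measurable_const (integrable_const _) one_pos
  have hdev : Tendsto (fun n => P.real {ω | ∃ x ∈ t,
      η x / 3 ≤ |A (fun w => q w x) n ω - ∫ ω, q (W 0 0 ω) x ∂P|}) minAtTop (𝓝 0) :=
    tendsto_measureReal_of_subset_biUnion t
      (B := fun x n => {ω | η x / 3 ≤ |A (fun w => q w x) n ω - ∫ ω, q (W 0 0 ω) x ∂P|})
      (Eventually.of_forall fun n => ae_of_all _ fun ω h => h)
      fun x hx => hlln x (htS x hx).1 _ (div_pos (hη_pos x (htS x hx)) three_pos)
  have hdev₀ : Tendsto (fun n => P.real {ω | ∃ x ∈ t,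
      η x / 3 ≤ |A (fun w => q w θ₀) n ω - ∫ ω, q (W 0 0 ω) θ₀ ∂P|}) minAtTop (𝓝 0) :=
    tendsto_measureReal_of_subset_biUnion t
      (B := fun x n => {ω | η x / 3 ≤ |A (fun w => q w θ₀) n ω - ∫ ω, q (W 0 0 ω) θ₀ ∂P|})
      (Eventually.of_forall fun n => ae_of_all _ fun ω h => h)
      fun x hx => hlln θ₀ hθ₀ _ (div_pos (hη_pos x (htS x hx)) three_pos)
  have hsum := (hone.add hdev).add hdev₀
  rw [add_zero, add_zero] at hsum
  refine squeeze_zero' (Eventually.of_forall fun n => measureReal_nonneg) ?_ hsum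
  filter_upwards [hp.eventually_gt_atTop 0] with n hL
  refine le_trans ?_ ((measureReal_union_le _ _).trans
    (add_le_add_left (measureReal_union_le _ _) _))
  -- Monotonicity holds for arbitrary sets, so no measurability of `θhat` is needed.
  refine ENNReal.toReal_mono (measure_ne_top _ _) (measure_mono_ae ?_)
  filter_upwards [hθhat n.1 n.2,
    ae_all_iff.2 fun i => ae_all_iff.2 fun j => (hZ n.1 n.2).ae_eq_zero_or_one i j,
    ae_all_iff.2 fun i => ae_all_iff.2 fun j => hlip i j] with ω hM hz hlipω hω
  by_contra hcon
  obtain ⟨h12, h3⟩ := not_or.1 hcon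
  obtain ⟨h1, h2⟩ := not_or.1 h12
  replace h1 : |A (fun _ => 1) n ω - 1| < 1 := not_le.1 h1
  replace h2 : ∀ x ∈ t, |A (fun w => q w x) n ω - ∫ ω, q (W 0 0 ω) x ∂P| < η x / 3 :=
    fun x hx => not_le.1 fun h => h2 ⟨x, hx, h⟩
  replace h3 : ∀ x ∈ t, |A (fun w => q w θ₀) n ω - ∫ ω, q (W 0 0 ω) θ₀ ∂P| < η x / 3 :=
    fun x hx => not_le.1 fun h => h3 ⟨x, hx, h⟩
  rw [abs_lt] at h1
  have hsize : 0 < subsampleSize (fun i j => Z n.1 n.2 i j ω) := by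
    have h : 0 < A (fun _ => 1) n ω := by linarith
    simp only [hA, weightedMean_one] at h
    exact pos_of_mul_pos_right h (inv_pos.2 hL).le
  have hmem := (hM hsize.ne').1
  obtain ⟨x, hx, hball⟩ := Set.mem_iUnion₂.1 (hcover ⟨hmem, hω⟩)
  have hηx := hη_pos x (htS x hx)
  have hmin : A (fun w => q w (θhat n.1 n.2 ω)) n ω ≤ A (fun w => q w θ₀) n ω :=
    hM.weightedMean_le hL hsize hθ₀
  have hclose : A (fun w => q w x) n ω ≤ A (fun w => q w (θhat n.1 n.2 ω)) n ω
      + η x / 6 * A (fun _ => 1) n ω := by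
    refine weightedMean_le_add hL (fun i j => ?_) fun i j => ?_
    · rcases hz i j with h | h <;> simp [h]
    · have h4 := (le_abs_self _).trans (hlipω i j x (htS x hx).1 _ hmem)
      have h5 : ‖x - θhat n.1 n.2 ω‖ < η x / (6 * (|C| + 1)) := by
        rw [← dist_eq_norm, dist_comm]
        exact hball
      have h6 : C * ‖x - θhat n.1 n.2 ω‖ ≤ (|C| + 1) * (η x / (6 * (|C| + 1))) :=
        mul_le_mul ((le_abs_self C).trans (by linarith)) h5.le (norm_nonneg _) (by positivity)
      have h7 : (|C| + 1) * (η x / (6 * (|C| + 1))) = η x / 6 := by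
        field_simp
      linarith
  have h4 := (abs_lt.1 (h2 x hx)).1
  have h5 := (abs_lt.1 (h3 x hx)).2
  have h6 : η x / 6 * A (fun _ => 1) n ω < η x / 6 * 2 := by
    gcongr
    linarith
  have h7 : η x = ∫ ω, q (W 0 0 ω) x ∂P - ∫ ω, q (W 0 0 ω) θ₀ ∂P := rfl
  linarith
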